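/- Let $A$ be a finite alphabet and let $\tau : A^* \to A^*$ be a substitution, that is, $\tau(uv) = \tau(u)\tau(v)$ for all words $u, v$. Assume that $\tau$ is primitive (there is $N$ such that for all $n \ge N$ and all $a, b \in A$ the letter $a$ occurs in $\tau^n(b)$) and Pisot (the complex eigenvalues of the matrix $(|\tau(a)|_b)_{a,b \in A}$, listed with algebraic multiplicity, are $\lambda_1, \ldots, \lambda_k$ with $|\lambda_1| > 1$ and $|\lambda_i| < 1$ for all $i > 1$). Let $X_\tau \subset A^{\mathbb N}$ be the set of infinite words all of whose finite factors occur in some $\tau^n(a)$, $a \in A$, $n \in \mathbb N$, let $\sigma$ be the shift on $A^{\mathbb N}$, and let $\tau$ act on $X_\tau$ by $\tau(x) = \tau(x_0)\tau(x_1)\cdots$. Then $\tau : X_\tau \to X_\tau$ is a dill map: $X_\tau$ is a subshift, $\tau$ maps $X_\tau$ continuously into itself, and the continuous function $s(x) = |\tau(x_0)|$ satisfies $\tau(\sigma(x)) = \sigma^{s(x)}(\tau(x))$ for all $x \in X_\tau$ and vanishes on no whole forward orbit. An implementation of this dill map is a continuous function $\phi : X_\tau \to A^*$ ($A^*$ discrete)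 with $\tau(x) = \phi(x)\phi(\sigma(x))\phi(\sigma^2(x))\cdots$ for all $x \in X_\tau$; in particular $\phi(x) = \tau(x_0)$ is one. Moreover, $\tau$ has balanced growth. That is, for the implementation $\phi(x) = \tau(x_0)$, and with ${}^n\phi(x) = \phi(x)\phi(\sigma(x))\cdots\phi(\sigma^{n-1}(x)) = \tau(x_{[0,n-1]})$: 1. the growth rate $Z$ exists: there is $Z \in \mathbb R$ such that $\lim_{n} |{}^n\phi(x)|/n = Z$ for all $x \in X_\tau$; 2. there is a (least) $D \in \mathbb N$ such that $Zn - D \le |{}^n\phi(x)| \le Zn + D$ for all $x \in X_\tau$ and all $n \in \mathbb N$. If $X_\tau$ contains no $\sigma$-periodic point, then statements 1 and 2 hold for every implementation $\phi$ of $\tau : X_\tau \to X_\tau$. -/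

import Mathlib

namespace Dill

open Filter Topology

section Words

variable {A B : Type*}

/-- The shift map on one-sided infinite words. -/
def shift (x : ℕ → A) : ℕ → A := fun i => x (i + 1)

/-- The word `x_i x_{i+1} ⋯ x_{i+n-1}`. -/
def factor (x : ℕ → A) (i n : ℕ) : List A := (List.range n).map (fun j => x (i + j))

/-- The finite word `w` is a factor of the infinite word `x`. -/
def IsFactor (w : List A) (x : ℕ → A) : Prop := ∃ i, factor x i w.length = w

/-- The finite word `w` is a prefix of the infinite word `x`. -/
def IsPrefix (w : List A) (x : ℕ → A) : Prop := factor x 0 w.length = w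

/-- The set of infinite words in which no word of `F` occurs. -/
def avoiding (F : Set (List A)) : Set (ℕ → A) := {x | ∀ w ∈ F, ¬ IsFactor w x}

/-- `x` is a `σ`-periodic point. -/
def IsShiftPeriodic (x : ℕ → A) : Prop := ∃ p : ℕ, 0 < p ∧ shift^[p] x = x

/-- `n`-fold concatenation `φ(x) φ(σ x) ⋯ φ(σ^{n-1} x)`. -/
def concat (φ : (ℕ → A) → List B) (n : ℕ) (x : ℕ → A) : List B :=
  (List.range n).flatMap (fun k => φ (shift^[k] x))

end Words

section DillMaps

variable {A B : Type*} [TopologicalSpace A] [TopologicalSpace B]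

/-- `s` is a nice cocycle on `X` for `Φ`: it is continuous on `X`, satisfies
`Φ(σ x) = σ^{s(x)}(Φ x)`, and does not vanish on any whole orbit. -/
structure IsNiceCocycle (X : Set (ℕ → A)) (Φ : (ℕ → A) → (ℕ → B))
    (s : (ℕ → A) → ℕ) : Prop where
  continuousOn : ContinuousOn s X
  cocycle : ∀ x ∈ X, Φ (shift x) = shift^[s x] (Φ x)
  nontrivial : ∀ x ∈ X, ∃ n : ℕ, 0 < s (shift^[n] x)

/-- `X` is a one-sided subshift. -/
structure IsSubshift (X : Set (ℕ → A)) : Prop where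
  isClosed : IsClosed X
  mapsTo : Set.MapsTo shift X X

/-- `Φ` restricts to a dill map from the subshift `X` to the subshift `Y`. -/
structure IsDillMap (X : Set (ℕ → A)) (Y : Set (ℕ → B)) (Φ : (ℕ → A) → (ℕ → B)) : Prop where
  source : IsSubshift X
  target : IsSubshift Y
  mapsTo : Set.MapsTo Φ X Y
  continuousOn : ContinuousOn Φ X
  exists_cocycle : ∃ s : (ℕ → A) → ℕ, IsNiceCocycle X Φ s

/-- `φ` is an implementation of `Φ` on `X`: it is continuous on `X` as a map to the discrete set
of finite words, and `Φ(x)` is the infinite concatenation `φ(x) φ(σ x) φ(σ² x) ⋯`. -/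
structure IsImplementation (X : Set (ℕ → A)) (Φ : (ℕ → A) → (ℕ → B))
    (φ : (ℕ → A) → List B) : Prop where
  locallyConstant : ∀ x ∈ X, ∀ᶠ y in 𝓝[X] x, φ y = φ x
  isPrefix : ∀ x ∈ X, ∀ n : ℕ, IsPrefix (concat φ n x) (Φ x)
  length_tendsto : ∀ x ∈ X, Tendsto (fun n => (concat φ n x).length) atTop atTop

end DillMaps

section Invariants

variable {A B : Type*}

/-- `Z(φ) = z`. -/
def HasZ (X : Set (ℕ → A)) (φ : (ℕ → A) → List B) (z : ℝ) : Prop :=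
  ∀ x ∈ X, Tendsto (fun n : ℕ => ((concat φ n x).length : ℝ) / (n : ℝ)) atTop (𝓝 z)

/-- `D(φ) = d`, relative to the value `z` of `Z(φ)`. -/
def HasD (X : Set (ℕ → A)) (φ : (ℕ → A) → List B) (z : ℝ) (d : ℕ) : Prop :=
  IsLeast {e : ℕ | ∀ x ∈ X, ∀ n : ℕ,
    ((concat φ n x).length : ℝ) ∈ Set.Icc (z * n - e) (z * n + e)} d

/-- Both invariants `Z` and `D` of the implementation `φ` are well-defined. -/
def HasBalancedGrowth (X : Set (ℕ → A)) (φ : (ℕ → A) → List B) : Prop :=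
  ∃ z : ℝ, HasZ X φ z ∧ ∃ d : ℕ, HasD X φ z d

end Invariants

section Substitutions

variable {A : Type*}

/-- The action on finite words of the substitution with letter images `τ a`. -/
def onWord (τ : A → List A) (w : List A) : List A := w.flatMap τ

/-- The action `x ↦ τ(x_0) τ(x_1) ⋯` on infinite words of a non-erasing substitution. Its letter
`i` is read off `τ(x_0 ⋯ x_i)`, which has length at least `i + 1` if `τ` is non-erasing (the default
value `x i` is never used then). -/
def onInf (τ : A → List A) (x : ℕ → A) : ℕ → A :=
  fun i => (onWord τ (factor x 0 (i + 1))).getD i (x i)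

/-- The one-sided subshift of a substitution: the words that occur in no `τ^n(a)` are forbidden. -/
def substSubshift (τ : A → List A) : Set (ℕ → A) :=
  avoiding {w | ∀ (a : A) (n : ℕ), ¬ w <:+: (onWord τ)^[n] [a]}

/-- Every letter occurs in `τ^n(b)` for every letter `b` and all large enough `n`. -/
def IsPrimitive (τ : A → List A) : Prop :=
  ∃ N : ℕ, ∀ n ≥ N, ∀ a b : A, a ∈ (onWord τ)^[n] [b]

/-- The subshift of `τ` contains no `σ`-periodic point. -/
def IsAperiodic (τ : A → List A) : Prop :=
  ∀ x ∈ substSubshift τ, ¬ IsShiftPeriodic x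

/-- The associated matrix, with entry `|τ(a)|_b` at `(a, b)`. -/
def assocMatrix [DecidableEq A] (τ : A → List A) : Matrix A A ℤ :=
  Matrix.of fun a b => ((τ a).count b : ℤ)

/-- The complex eigenvalues of the associated matrix, listed with algebraic multiplicity, are
`l` with `|l| > 1` and others of modulus less than `1`. -/
def IsPisot [Fintype A] [DecidableEq A] (τ : A → List A) : Prop :=
  ∃ (l : ℂ) (s : Multiset ℂ),
    ((assocMatrix τ).map (Int.castRingHom ℂ)).charpoly.roots = l ::ₘ s ∧
      1 < ‖l‖ ∧ ∀ m ∈ s, ‖m‖ < 1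

end Substitutions

end Dill

namespace Dill

open Filter Topology

/-! ### Factors, concatenations and bounded error -/

section Words

variable {A B : Type*}

/-! Let `M` be the associated matrix, `l` its dominant eigenvalue and `v = M 1 - l 1`. Summing the
weights `v` over the letters of `w` gives `|τ(w)| - l |w|`, so balanced growth asks for a bound on
these sums, uniform over all factors of all `τ^n(a)`. Such a factor is `s τ(u) p` with `s`, `p` of
bounded length and `u` a factor of `τ^(n-1)(a)`; the `v`-sum over `τ(u)` is the `M v`-sum over `u`.
Iterating (`norm_sum_map_infix_le`) bounds the discrepancy by a constant times `∑ ‖M^k v‖`. By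
Cayley-Hamilton the eigenvalues other than `l` already annihilate `v`, so the series converges
(`summable_norm_pow_mulVec`). Without periodic points, the relation `Φ(σ x) = σ^{|φ(x)|}(Φ x)`
determines `|φ(x)|`, so all implementations share the same lengths (`IsImplementation.length_eq`).
-/

lemma factor_length (x : ℕ → A) (i n : ℕ) : (factor x i n).length = n := by simp [factor]

lemma shift_iterate_apply (x : ℕ → A) (n i : ℕ) : shift^[n] x i = x (n + i) := by
  induction n generalizing x with
  | zero => simp
  | succ n ih => rw [Function.iterate_succ_apply, ih, shift]; congr 1; omega

lemma factor_add (x : ℕ → A) (i m n : ℕ) :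
    factor x i (m + n) = factor x i m ++ factor x (i + m) n := by
  simp [factor, List.range_add, Function.comp_def, add_assoc]

lemma isPrefix_iff (w : List A) (x : ℕ → A) :
    IsPrefix w x ↔ ∀ i (h : i < w.length), x i = w[i] := by
  constructor
  · intro h i hi
    have h' : factor x 0 w.length = w := h
    have : (factor x 0 w.length)[i]'(by simpa [factor_length] using hi) = w[i] := by
      simp only [h']
    simpa [factor] using this
  · intro h
    refine List.ext_getElem (factor_length _ _ _) fun i h₁ h₂ => ?_
    simpa [factor] using h i h₂

lemma concat_succ (φ : (ℕ → A) → List B) (n : ℕ) (x : ℕ → A) :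
    concat φ (n + 1) x = φ x ++ concat φ n (shift x) := by
  simp [concat, List.range_succ_eq_map, List.flatMap_map]

lemma concat_length_congr {X : Set (ℕ → A)} (hX : Set.MapsTo shift X X)
    {φ ψ : (ℕ → A) → List B} (h : ∀ x ∈ X, (φ x).length = (ψ x).length) (n : ℕ) {x : ℕ → A}
    (hx : x ∈ X) : (concat φ n x).length = (concat ψ n x).length := by
  induction n generalizing x with
  | zero => simp [concat]
  | succ n ih => simp [concat_succ, h x hx, ih (hX hx)]

lemma HasBalancedGrowth.congr {X : Set (ℕ → A)} (hX : Set.MapsTo shift X X)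
    {φ ψ : (ℕ → A) → List B} (h : ∀ x ∈ X, (φ x).length = (ψ x).length)
    (hφ : HasBalancedGrowth X φ) : HasBalancedGrowth X ψ := by
  obtain ⟨z, hz, d, hd⟩ := hφ
  have key := fun x hx n => concat_length_congr hX h n (x := x) hx
  refine ⟨z, fun x hx => ?_, d, ?_⟩
  · simpa only [key x hx] using hz x hx
  · have : {e : ℕ | ∀ x ∈ X, ∀ n : ℕ,
        ((concat ψ n x).length : ℝ) ∈ Set.Icc (z * n - e) (z * n + e)} =
        {e : ℕ | ∀ x ∈ X, ∀ n : ℕ,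
        ((concat φ n x).length : ℝ) ∈ Set.Icc (z * n - e) (z * n + e)} := by
      ext e
      exact forall₂_congr fun x hx => forall_congr' fun n => by rw [key x hx n]
    rw [HasD, this]
    exact hd

/-- A uniform linear estimate with bounded error yields both invariants. -/
lemma hasBalancedGrowth_of_bound {X : Set (ℕ → A)} {φ : (ℕ → A) → List B} (z c : ℝ)
    (h : ∀ x ∈ X, ∀ n : ℕ, |((concat φ n x).length : ℝ) - z * n| ≤ c) :
    HasBalancedGrowth X φ := by
  classical
  refine ⟨z, fun x hx => ?_, ?_⟩
  · rw [tendsto_iff_norm_sub_tendsto_zero]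
    refine squeeze_zero' (Eventually.of_forall fun _ => norm_nonneg _) ?_
      (tendsto_const_div_atTop_nhds_zero_nat c)
    filter_upwards [eventually_gt_atTop 0] with n hn
    have hn' : (0 : ℝ) < n := by exact_mod_cast hn
    have : ((concat φ n x).length : ℝ) / n - z = (((concat φ n x).length : ℝ) - z * n) / n := by
      field_simp
    rw [this, norm_div, Real.norm_eq_abs, Real.norm_of_nonneg hn'.le]
    gcongr
    exact h x hx n
  · have hex : ∃ e : ℕ, ∀ x ∈ X, ∀ n : ℕ,
        ((concat φ n x).length : ℝ) ∈ Set.Icc (z * n - e) (z * n + e) := by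
      refine ⟨⌈c⌉₊, fun x hx n => ?_⟩
      have h₁ := abs_le.1 (h x hx n)
      have h₂ := Nat.le_ceil c
      constructor <;> linarith
    exact ⟨Nat.find hex, Nat.find_spec hex, fun e he => Nat.find_min' hex he⟩

end Words

/-! ### Lengths of implementations -/

section Implementations

variable {A B : Type*} [TopologicalSpace A]

/-- The lengths of an implementation form a cocycle. -/
lemma IsImplementation.apply_shift {X : Set (ℕ → A)} (hX : Set.MapsTo shift X X)
    {Φ : (ℕ → A) → (ℕ → B)} {φ : (ℕ → A) → List B} (h : IsImplementation X Φ φ)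
    {x : ℕ → A} (hx : x ∈ X) : Φ (shift x) = shift^[(φ x).length] (Φ x) := by
  funext i
  -- With `n` large enough to cover position `i`, the same letter is read in the prefix of `Φ (shift
  -- x)` and, displaced by `|φ(x)|`, in that of `Φ x`.
  obtain ⟨n, hn⟩ := ((h.length_tendsto _ (hX hx)).eventually_gt_atTop i).exists
  have h₁ := (isPrefix_iff _ _).1 (h.isPrefix _ (hX hx) n) i hn
  have h₂ := (isPrefix_iff _ _).1 (h.isPrefix _ hx (n + 1)) ((φ x).length + i)
    (by simpa [concat_succ] using hn)
  rw [shift_iterate_apply, h₁, h₂]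
  simp [concat_succ]

/-- Two implementations of a map into a shift-invariant set without periodic points have the
same lengths. -/
lemma IsImplementation.length_eq {X : Set (ℕ → A)} {Y : Set (ℕ → B)}
    (hX : Set.MapsTo shift X X) (hY : Set.MapsTo shift Y Y) {Φ : (ℕ → A) → (ℕ → B)}
    (hΦ : Set.MapsTo Φ X Y) (haper : ∀ y ∈ Y, ¬ IsShiftPeriodic y)
    {φ ψ : (ℕ → A) → List B} (hφ : IsImplementation X Φ φ) (hψ : IsImplementation X Φ ψ)
    {x : ℕ → A} (hx : x ∈ X) : (φ x).length = (ψ x).length := by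
  -- Two exponents `a < b` would make `shift^[a] (Φ x)` periodic with period `b - a`.
  have key : ∀ a b : ℕ, shift^[a] (Φ x) = shift^[b] (Φ x) → ¬ a < b := by
    intro a b hab hlt
    refine haper _ (hY.iterate a (hΦ hx)) ⟨b - a, by omega, ?_⟩
    rw [← Function.iterate_add_apply, Nat.sub_add_cancel hlt.le, hab]
  have h := (hφ.apply_shift hX hx).symm.trans (hψ.apply_shift hX hx)
  exact le_antisymm (not_lt.1 (key _ _ h.symm)) (not_lt.1 (key _ _ h))

end Implementations

/-! ### The dill map of a substitution -/

section Substitutions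

variable {A : Type*}

lemma onWord_append (τ : A → List A) (u v : List A) :
    onWord τ (u ++ v) = onWord τ u ++ onWord τ v := by simp [onWord]

lemma onWord_infix (τ : A → List A) {u v : List A} (h : u <:+: v) :
    onWord τ u <:+: onWord τ v := by
  obtain ⟨s, t, rfl⟩ := h
  rw [onWord_append, onWord_append]
  exact List.infix_append _ _ _

/-- If `τ a` were empty, so would be `τ^(N+1)(a)`, which must contain `a`. -/
lemma IsPrimitive.ne_nil {τ : A → List A} (h : IsPrimitive τ) (a : A) : τ a ≠ [] := by
  intro ha
  obtain ⟨N, hN⟩ := h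
  have h0 : ∀ n, (onWord τ)^[n] ([] : List A) = [] := fun n => by
    induction n with
    | zero => rfl
    | succ n ih => rw [Function.iterate_succ_apply]; simpa [onWord] using ih
  have := hN (N + 1) (by omega) a a
  rw [Function.iterate_succ_apply] at this
  simp [onWord, ha] at this
  simp [h0] at this

lemma length_le_length_onWord {τ : A → List A} (hτ : ∀ a, τ a ≠ []) (w : List A) :
    w.length ≤ (onWord τ w).length := by
  induction w with
  | nil => simp
  | cons a w ih =>
    have := List.length_pos_of_ne_nil (hτ a)
    simp only [onWord, List.flatMap_cons, List.length_append, List.length_cons] at ih ⊢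
    omega

lemma isPrefix_onWord_factor {τ : A → List A} (hτ : ∀ a, τ a ≠ []) (x : ℕ → A) (n : ℕ) :
    IsPrefix (onWord τ (factor x 0 n)) (onInf τ x) := by
  rw [isPrefix_iff]
  intro i hi
  have hi' : i < (onWord τ (factor x 0 (i + 1))).length :=
    lt_of_lt_of_le (by rw [factor_length]; omega) (length_le_length_onWord hτ _)
  -- The words `τ(x_0 ⋯ x_{n-1})` and `τ(x_0 ⋯ x_i)` are both prefixes of `τ(x_0 ⋯ x_{n+i})`, hence
  -- agree at position `i`.
  have hpre : ∀ m k, onWord τ (factor x 0 m) <+: onWord τ (factor x 0 (m + k)) := fun m k => by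
    rw [factor_add, onWord_append]; exact List.prefix_append _ _
  have h₁ := (hpre n (i + 1)).getElem hi
  have h₂ := (hpre (i + 1) n).getElem hi'
  rw [onInf, List.getD_eq_getElem _ _ hi', h₁, h₂]
  simp only [add_comm]

lemma concat_apply_zero (τ : A → List A) (n : ℕ) (x : ℕ → A) :
    concat (fun x => τ (x 0)) n x = onWord τ (factor x 0 n) := by
  simp [concat, onWord, factor, List.flatMap_map, shift_iterate_apply]

lemma isFactor_shift {w : List A} {x : ℕ → A} (h : IsFactor w (shift x)) : IsFactor w x := by
  obtain ⟨i, hi⟩ := h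
  refine ⟨i + 1, ?_⟩
  rw [← hi]
  simp [factor, shift, add_assoc, add_comm, add_left_comm]

lemma mem_substSubshift_iff {τ : A → List A} {x : ℕ → A} :
    x ∈ substSubshift τ ↔ ∀ i n, ∃ a m, factor x i n <:+: (onWord τ)^[m] [a] := by
  constructor
  · intro h i n
    by_contra! hc
    exact h _ hc ⟨i, by rw [factor_length]⟩
  · rintro h w hw ⟨i, hi⟩
    obtain ⟨a, m, ham⟩ := h i w.length
    rw [hi] at ham
    exact hw a m ham

lemma mapsTo_shift_substSubshift (τ : A → List A) :
    Set.MapsTo shift (substSubshift τ) (substSubshift τ) :=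
  fun _ hx w hw h => hx w hw (isFactor_shift h)

lemma mapsTo_onInf_substSubshift {τ : A → List A} (hτ : ∀ a, τ a ≠ []) :
    Set.MapsTo (onInf τ) (substSubshift τ) (substSubshift τ) := by
  intro x hx
  rw [mem_substSubshift_iff] at hx ⊢
  intro i n
  obtain ⟨a, m, h⟩ := hx 0 (i + n)
  refine ⟨a, m + 1, ?_⟩
  rw [Function.iterate_succ_apply']
  refine List.IsInfix.trans ?_ (onWord_infix τ h)
  -- Since `τ` is non-erasing, this prefix of the image already covers the window from `i` to `i +
  -- n`.
  set w := onWord τ (factor x 0 (i + n)) with hw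
  have hlen : i + n ≤ w.length := by
    simpa [factor_length] using length_le_length_onWord hτ (factor x 0 (i + n))
  have hp : factor (onInf τ x) 0 w.length = w := isPrefix_onWord_factor hτ x (i + n)
  rw [← hp, ← Nat.add_sub_cancel' hlen, factor_add, factor_add, zero_add]
  exact List.infix_append _ _ _

variable [TopologicalSpace A] [DiscreteTopology A]

lemma continuous_factor (i n : ℕ) : Continuous[_, ⊥] fun x : ℕ → A => factor x i n := by
  let _ : TopologicalSpace (List A) := ⊥
  have _ : DiscreteTopology (List A) := ⟨rfl⟩
  have : (fun x : ℕ → A => factor x i n) =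
      (fun y : Fin n → A => List.ofFn y) ∘ fun x j => x (i + j) := by
    funext x
    apply List.ext_getElem <;> simp [factor]
  rw [this]
  exact continuous_of_discreteTopology.comp (by fun_prop)

lemma isClosed_avoiding (F : Set (List A)) : IsClosed (avoiding F) := by
  let _ : TopologicalSpace (List A) := ⊥
  have _ : DiscreteTopology (List A) := ⟨rfl⟩
  have : avoiding F = ⋂ w ∈ F, ⋂ i, (fun x => factor x i w.length) ⁻¹' {w}ᶜ := by
    ext x
    simp [avoiding, IsFactor]
  rw [this]
  exact isClosed_biInter fun w _ => isClosed_iInter fun i =>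
    (isClosed_discrete _).preimage (continuous_factor i _)

lemma isSubshift_substSubshift (τ : A → List A) : IsSubshift (substSubshift τ) :=
  ⟨isClosed_avoiding _, mapsTo_shift_substSubshift τ⟩

lemma continuous_onInf (τ : A → List A) : Continuous (onInf τ) := by
  let _ : TopologicalSpace (List A) := ⊥
  have _ : DiscreteTopology (List A) := ⟨rfl⟩
  refine continuous_pi fun i => ?_
  exact (continuous_of_discreteTopology (f := fun p : List A × A => (onWord τ p.1).getD i p.2)).comp
    ((continuous_factor 0 (i + 1)).prodMk (continuous_apply i))

lemma isImplementation_onInf {τ : A → List A} (hτ : ∀ a, τ a ≠ []) (X : Set (ℕ → A)) :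
    IsImplementation X (onInf τ) (fun x => τ (x 0)) where
  locallyConstant x _ := by
    have h : {y : ℕ → A | y 0 = x 0} ∈ 𝓝 x :=
      ((isOpen_discrete ({x 0} : Set A)).preimage
        (continuous_apply (A := fun _ : ℕ => A) 0)).mem_nhds rfl
    filter_upwards [mem_nhdsWithin_of_mem_nhds h] with y hy
    exact congrArg τ hy
  isPrefix x _ n := by
    rw [concat_apply_zero]
    exact isPrefix_onWord_factor hτ x n
  length_tendsto x _ := by
    refine tendsto_atTop_mono (fun n => ?_) tendsto_id
    rw [concat_apply_zero]
    simpa [factor_length] using length_le_length_onWord hτ (factor x 0 n)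

lemma isNiceCocycle_onInf {τ : A → List A} (hτ : ∀ a, τ a ≠ []) :
    IsNiceCocycle (substSubshift τ) (onInf τ) (fun x => (τ (x 0)).length) where
  continuousOn := ((continuous_of_discreteTopology (f := fun a => (τ a).length)).comp
    (continuous_apply 0)).continuousOn
  cocycle _ hx := (isImplementation_onInf hτ _).apply_shift (mapsTo_shift_substSubshift τ) hx
  nontrivial _ _ := ⟨0, List.length_pos_of_ne_nil (hτ _)⟩

end Substitutions

/-! ### Bounded discrepancy of Pisot substitutions -/

section Growth

open Polynomial Matrix

variable {A : Type*}

/-- Summing the recursion, the partial sums satisfy `S_n ≤ S_{n+1} ≤ a 0 + r S_n + ∑ b`, which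
bounds `S_n` as `r < 1`. -/
lemma summable_of_succ_le {a b : ℕ → ℝ} {r : ℝ} (hr : r < 1) (ha : ∀ n, 0 ≤ a n)
    (hb : ∀ n, 0 ≤ b n) (hs : Summable b) (h : ∀ n, a (n + 1) ≤ r * a n + b n) : Summable a := by
  refine summable_of_sum_range_le (c := (a 0 + ∑' n, b n) / (1 - r)) ha fun n => ?_
  rw [le_div_iff₀ (by linarith)]
  have h₁ : ∑ i ∈ Finset.range n, a (i + 1) ≤
      r * ∑ i ∈ Finset.range n, a i + ∑ i ∈ Finset.range n, b i := by
    rw [Finset.mul_sum, ← Finset.sum_add_distrib]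
    exact Finset.sum_le_sum fun i _ => h i
  have h₂ := hs.sum_le_tsum (Finset.range n) fun i _ => hb i
  have h₃ := Finset.sum_range_succ a n
  rw [Finset.sum_range_succ'] at h₃
  linarith [ha n]

/-- If `v` is killed by a polynomial in `M` whose roots all have modulus less than `1`, then the
orbit of `v` under `M` is summable. -/
lemma summable_norm_pow_mulVec [Fintype A] [DecidableEq A] (M : Matrix A A ℂ) (s : Multiset ℂ)
    (hs : ∀ m ∈ s, ‖m‖ < 1) (v : A → ℂ)
    (hv : (aeval M (s.map fun m => X - C m).prod) *ᵥ v = 0) :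
    Summable fun k => ‖(M ^ k) *ᵥ v‖ := by
  induction s using Multiset.induction generalizing v with
  | empty =>
    have : v = 0 := by simpa using hv
    simp [this]
  | cons m s ih =>
    -- The remaining factors kill `M v - m v`, which drives the recursion for `M^n v`. No
    -- diagonalisability is needed, so repeated roots are allowed.
    have hsum := ih (fun i hi => hs i (Multiset.mem_cons_of_mem hi)) (M *ᵥ v - m • v) (by
      rw [Multiset.map_cons, Multiset.prod_cons, mul_comm, map_mul, ← mulVec_mulVec] at hv
      simpa [sub_mulVec, Algebra.algebraMap_eq_smul_one, smul_mulVec] using hv)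
    refine summable_of_succ_le (hs m (Multiset.mem_cons_self m s)) (fun _ => norm_nonneg _)
      (fun _ => norm_nonneg _) hsum fun n => ?_
    have : (M ^ (n + 1)) *ᵥ v = m • ((M ^ n) *ᵥ v) + (M ^ n) *ᵥ (M *ᵥ v - m • v) := by
      rw [mulVec_sub, mulVec_mulVec, ← pow_succ, mulVec_smul]
      abel
    rw [this, ← norm_smul]
    exact norm_add_le _ _

lemma exists_of_prefix_onWord {τ : A → List A} {L : ℕ} (hL : ∀ a, (τ a).length ≤ L)
    {w u : List A} (h : w <+: onWord τ u) :
    ∃ u' p, u' <+: u ∧ p.length ≤ L ∧ w = onWord τ u' ++ p := by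
  induction u generalizing w with
  | nil => exact ⟨[], [], by simp, by simp, by simpa [onWord] using h⟩
  | cons a u ih =>
    obtain ⟨t, ht⟩ := h
    rw [onWord, List.flatMap_cons, List.append_eq_append_iff] at ht
    obtain ⟨b, hb, -⟩ | ⟨c, rfl, hc⟩ := ht
    · refine ⟨[], w, by simp, le_trans ?_ (hL a), by simp [onWord]⟩
      simp [hb]
    · obtain ⟨u', p, hu', hp, rfl⟩ := ih ⟨t, hc.symm⟩
      exact ⟨a :: u', p, by simpa using hu', hp, by simp [onWord]⟩

/-- Cutting `w` at the boundaries between letter images leaves incomplete images only at its two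
ends. -/
lemma exists_of_infix_onWord {τ : A → List A} {L : ℕ} (hL : ∀ a, (τ a).length ≤ L)
    {w u : List A} (h : w <:+: onWord τ u) :
    ∃ s u' p, u' <:+: u ∧ s.length ≤ L ∧ p.length ≤ L ∧ w = s ++ onWord τ u' ++ p := by
  induction u with
  | nil => exact ⟨[], [], [], by simp, by simp, by simp, by simpa [onWord] using h⟩
  | cons a u ih =>
    rw [onWord, List.flatMap_cons, List.infix_append_iff] at h
    obtain h | h | ⟨s, w', rfl, hs, hw'⟩ := h
    · exact ⟨w, [], [], by simp, h.length_le.trans (hL a), by simp, by simp [onWord]⟩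
    · obtain ⟨s, u', p, hu', hs, hp, rfl⟩ := ih h
      exact ⟨s, u', p, hu'.trans (List.suffix_cons a u).isInfix, hs, hp, rfl⟩
    · obtain ⟨u', p, hu', hp, rfl⟩ := exists_of_prefix_onWord hL hw'
      exact ⟨s, u', p, hu'.isInfix.trans (List.suffix_cons a u).isInfix,
        hs.length_le.trans (hL a), hp, by simp⟩

lemma norm_sum_map_le [Fintype A] (w : List A) (v : A → ℂ) :
    ‖(w.map v).sum‖ ≤ w.length * ‖v‖ := by
  induction w with
  | nil => simp
  | cons a w ih =>
    have h₁ := norm_add_le (v a) (w.map v).sum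
    have h₂ := norm_le_pi_norm v a
    simp only [List.map_cons, List.sum_cons, List.length_cons, Nat.cast_add, Nat.cast_one]
    linarith

variable [Fintype A] [DecidableEq A]

/-- The associated matrix computes additive weights of images of words. -/
lemma sum_map_onWord (τ : A → List A) (v : A → ℂ) (w : List A) :
    ((onWord τ w).map v).sum =
      (w.map (((assocMatrix τ).map (Int.castRingHom ℂ)) *ᵥ v)).sum := by
  have h : ∀ a, (((assocMatrix τ).map (Int.castRingHom ℂ)) *ᵥ v) a = ((τ a).map v).sum := by
    intro a
    rw [Finset.sum_list_map_count, Finset.sum_subset (Finset.subset_univ _)]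
    · simp [mulVec, dotProduct, assocMatrix]
    · intro b _ hb
      simp [List.count_eq_zero_of_not_mem (by simpa using hb)]
  induction w with
  | nil => simp [onWord]
  | cons a w ih =>
    rw [List.map_cons, List.sum_cons, ← ih, h]
    simp [onWord]

/-- Each desubstitution replaces `M^k v` by `M^(k+1) v` and costs two end words of length at most
`L`, whence the factor `2 * L`. -/
lemma norm_sum_map_infix_le (τ : A → List A) (v : A → ℂ) {L : ℕ} (hL : ∀ a, (τ a).length ≤ L)
    (hL1 : 1 ≤ L) (a : A) (n k : ℕ) {w : List A} (hw : w <:+: (onWord τ)^[n] [a]) :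
    ‖(w.map ((((assocMatrix τ).map (Int.castRingHom ℂ)) ^ k) *ᵥ v)).sum‖ ≤
      2 * L * ∑ j ∈ Finset.range (n + 1),
        ‖(((assocMatrix τ).map (Int.castRingHom ℂ)) ^ (k + j)) *ᵥ v‖ := by
  set M := (assocMatrix τ).map (Int.castRingHom ℂ) with hM
  have short : ∀ (s : List A), s.length ≤ L →
      ‖(s.map ((M ^ k) *ᵥ v)).sum‖ ≤ L * ‖(M ^ k) *ᵥ v‖ := fun s hs =>
    (norm_sum_map_le _ _).trans (by gcongr)
  induction n generalizing k w with
  | zero =>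
    have h := short w (hw.length_le.trans (by simpa using hL1))
    have : 0 ≤ L * ‖(M ^ k) *ᵥ v‖ := by positivity
    simp only [zero_add, Finset.sum_range_one, add_zero]
    linarith
  | succ n ih =>
    rw [Function.iterate_succ_apply'] at hw
    obtain ⟨s, u, p, hu, hs, hp, rfl⟩ := exists_of_infix_onWord hL hw
    have hmid := ih (k + 1) hu fun s hs => (norm_sum_map_le _ _).trans (by gcongr)
    rw [List.map_append, List.map_append, List.sum_append, List.sum_append, sum_map_onWord,
      ← hM, mulVec_mulVec, ← pow_succ', Finset.sum_range_succ']
    refine (norm_add₃_le).trans ?_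
    simp only [add_assoc, add_comm 1] at hmid
    have := short s hs
    have := short p hp
    simp only [add_zero]
    linarith

/-- The discrepancy of image lengths of factors of a Pisot substitution is bounded. -/
lemma IsPisot.exists_bound {τ : A → List A} (h : IsPisot τ) :
    ∃ z c : ℝ, ∀ (a : A) (n : ℕ) (w : List A), w <:+: (onWord τ)^[n] [a] →
      |((onWord τ w).length : ℝ) - z * w.length| ≤ c := by
  obtain ⟨l, s, hroots, -, hs⟩ := h
  set M := (assocMatrix τ).map (Int.castRingHom ℂ) with hM
  set v : A → ℂ := M *ᵥ 1 - l • 1 with hv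
  have hsum : Summable fun k => ‖(M ^ k) *ᵥ v‖ := by
    refine summable_norm_pow_mulVec M s hs v ?_
    -- Cayley-Hamilton: as `v = (M - l) 1`, the product of the other linear factors of the
    -- characteristic polynomial kills `v`.
    have h₁ := (IsAlgClosed.splits M.charpoly).eq_prod_roots_of_monic M.charpoly_monic
    have h₂ := M.aeval_self_charpoly
    rw [h₁, hroots, Multiset.map_cons, Multiset.prod_cons, mul_comm, map_mul] at h₂
    have h₃ : v = (aeval M (X - C l)) *ᵥ 1 := by
      simp [hv, sub_mulVec, Algebra.algebraMap_eq_smul_one, smul_mulVec]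
    rw [h₃, mulVec_mulVec, h₂, zero_mulVec]
  -- The extra `1` lets `L` also bound the one-letter word at the base of the desubstitution.
  set L := (∑ a, (τ a).length) + 1
  have hL : ∀ a, (τ a).length ≤ L := fun a =>
    (Finset.single_le_sum (f := fun a => (τ a).length) (fun _ _ => Nat.zero_le _)
      (Finset.mem_univ a)).trans (Nat.le_succ _)
  -- Lengths are real, so passing to real parts gives the bound with `l.re`, without showing that
  -- `l` is real.
  refine ⟨l.re, 2 * L * ∑' k, ‖(M ^ k) *ᵥ v‖, fun a n w hw => ?_⟩
  have h₁ := norm_sum_map_infix_le τ v hL (by omega) a n 0 hw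
  rw [← hM, pow_zero, one_mulVec] at h₁
  simp only [zero_add] at h₁
  have h₂ := hsum.sum_le_tsum (Finset.range (n + 1)) fun i _ => norm_nonneg _
  have h₃ : (w.map v).sum = (onWord τ w).length - l * w.length := by
    have h₄ := sum_map_onWord τ 1 w
    have h₅ : ∀ u : List A, (u.map (1 : A → ℂ)).sum = u.length := fun u => by
      induction u with
      | nil => simp
      | cons a u ih => simp [ih, add_comm]
    have h₆ : ∀ u : List A, (u.map v).sum = (u.map (M *ᵥ 1)).sum - l * u.length := fun u => by
      induction u with
      | nil => simp
      | cons a u ih =>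
        rw [List.map_cons, List.map_cons, List.sum_cons, List.sum_cons, ih]
        simp only [hv, Pi.sub_apply, Pi.smul_apply,
          Pi.one_apply, smul_eq_mul, List.length_cons, Nat.cast_add, Nat.cast_one]
        ring
    rw [h₆, ← h₅ (onWord τ w), h₄]
  have h₄ : ((onWord τ w).length : ℝ) - l.re * w.length = ((w.map v).sum).re := by
    simp [h₃]
  rw [h₄]
  refine (Complex.abs_re_le_norm _).trans (h₁.trans ?_)
  gcongr

lemma IsPisot.hasBalancedGrowth {τ : A → List A} (h : IsPisot τ) :
    HasBalancedGrowth (substSubshift τ) (fun x => τ (x 0)) := by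
  obtain ⟨z, c, hzc⟩ := h.exists_bound
  refine hasBalancedGrowth_of_bound z c fun x hx n => ?_
  obtain ⟨a, m, ham⟩ := mem_substSubshift_iff.1 hx 0 n
  have := hzc a m _ ham
  rwa [factor_length, ← concat_apply_zero] at this

end Growth

end Dill

theorem mainTheorem6 {A : Type*} [Fintype A] [DecidableEq A]
    [TopologicalSpace A] [DiscreteTopology A] (τ : A → List A)
    (hprim : Dill.IsPrimitive τ) (hpisot : Dill.IsPisot τ) :
    Dill.IsDillMap (Dill.substSubshift τ) (Dill.substSubshift τ) (Dill.onInf τ) ∧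
    Dill.IsNiceCocycle (Dill.substSubshift τ) (Dill.onInf τ) (fun x => (τ (x 0)).length) ∧
    Dill.IsImplementation (Dill.substSubshift τ) (Dill.onInf τ) (fun x => τ (x 0)) ∧
    Dill.HasBalancedGrowth (Dill.substSubshift τ) (fun x => τ (x 0)) ∧
    (Dill.IsAperiodic τ → ∀ φ : (ℕ → A) → List A,
      Dill.IsImplementation (Dill.substSubshift τ) (Dill.onInf τ) φ →
        Dill.HasBalancedGrowth (Dill.substSubshift τ) φ) := by
  have hτ := hprim.ne_nil
  have himp := Dill.isImplementation_onInf hτ (Dill.substSubshift τ)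
  have hX := Dill.mapsTo_shift_substSubshift τ
  have hΦ := Dill.mapsTo_onInf_substSubshift hτ
  have hcoc := Dill.isNiceCocycle_onInf hτ
  have hsub := Dill.isSubshift_substSubshift τ
  exact ⟨⟨hsub, hsub, hΦ, (Dill.continuous_onInf τ).continuousOn, _, hcoc⟩, hcoc, himp,
    hpisot.hasBalancedGrowth, fun haper φ hφ =>
      hpisot.hasBalancedGrowth.congr hX fun x hx => himp.length_eq hX hX hΦ haper hφ hx⟩
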